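/- Let $(\Omega,\mathcal F,P)$ be a nonatomic standard Borel probability space and $L^1=L^1(\Omega,\mathcal F,P)$. A risk measure on $L^1$ is a functional $\rho:L^1\to(-\infty,\infty]$ that is monotone ($X\le Y$ a.s. implies $\rho(X)\le\rho(Y)$), cash additive ($\rho(X+c)=\rho(X)+c$ for $c\in\mathbb R$), normalized ($\rho(0)=0$) and convex. It is law invariant if $\rho(X)=\rho(Y)$ whenever $X,Y\in L^1$ have the same law; then $\tilde\rho(P\circ X^{-1})=\rho(X)$ defines a functional $\tilde\rho$ on the laws on $\mathbb R$ with finite first moment, and for a $\sigma$-field $\mathcal G\subset\mathcal F$ and $X\in L^1$ one sets $\rho(X|\mathcal G):=\tilde\rho(P(X\in\cdot\,|\,\mathcal G))$, where $P(X\in\cdot\,|\,\mathcal G)$ is the regular conditional law. A law invariant risk measure $\rho$ is acceptance consistent if $\rho(X)\le\rho(\rho(X|\mathcal G))$ for every $\sigma$-field $\mathcal G\subset\mathcal F$ and every $X\in L^1$ with $\rho(X|\mathcal G)\in L^1$. Proposition. Let $\rho$ be an acceptance consistent law invariant risk measure on $L^1$. For $i=1,\dots,n$ let $(E_i,d_i)$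 be a complete separable metric space and $X_i:\Omega\to E_i$ a random variable whose law $\mu_i$ has a finite first moment, i.e. $\int_{E_i}d_i(x,x_0)\,\mu_i(dx)<\infty$ for some $x_0\in E_i$. Suppose that $X_1,\dots,X_n$ are independent. Let $\gamma_i:[0,\infty)\to[-\infty,\infty]$ be functions such that, for each $i$, each $\lambda\ge0$ and each $1$-Lipschitz function $f:E_i\to\mathbb R$, $$\rho\big(\lambda(f(X_i)-\mathbb E f(X_i))\big)\le\gamma_i(\lambda).$$ Equip $E=E_1\times\cdots\times E_n$ with the $\ell^1$-metric $d(x,y)=\sum_{i=1}^n d_i(x_i,y_i)$. Then for every $1$-Lipschitz function $f:E\to\mathbb R$ the random variable $f(X_1,\dots,X_n)$ is integrable and $$\rho\Big(\lambda\big(f(X_1,\dots,X_n)-\mathbb E f(X_1,\dots,X_n)\big)\Big)\le\sum_{i=1}^n\gamma_i(\lambda)\qquad\text{for all }\lambda\ge0.$$ (The hypothesis with $f=0$ forces $\gamma_i\ge0$, so the sum is well defined.) -/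

import Mathlib

open MeasureTheory ProbabilityTheory
open scoped NNReal

/-- A (convex, normalized) risk measure on `L¹(Ω, P)`: a functional `ρ : L¹ → (-∞, ∞]` that is
monotone, cash additive, normalized and convex. The order on `L¹` is the almost sure one. -/
structure RiskMeasure {Ω : Type*} {mΩ : MeasurableSpace Ω} (P : Measure Ω) [IsProbabilityMeasure P] where
  toFun : Lp ℝ 1 P → EReal
  ne_bot : ∀ X, toFun X ≠ ⊥
  mono : ∀ X Y, X ≤ Y → toFun X ≤ toFun Y
  cash_additive : ∀ (X : Lp ℝ 1 P) (c : ℝ), toFun (X + Lp.const 1 P c) = toFun X + (c : EReal)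
  normalized : toFun 0 = 0
  convex : ∀ (X Y : Lp ℝ 1 P) (t : ℝ), 0 < t → t < 1 →
    toFun (t • X + (1 - t) • Y) ≤ (t : EReal) * toFun X + ((1 - t : ℝ) : EReal) * toFun Y

namespace RiskMeasure

variable {Ω : Type*} {mΩ : MeasurableSpace Ω} {P : Measure Ω} [IsProbabilityMeasure P]

instance : CoeFun (RiskMeasure P) (fun _ => Lp ℝ 1 P → EReal) := ⟨RiskMeasure.toFun⟩

/-- `ρ` is law invariant: `ρ(X)` depends only on the law of `X` under `P`. -/
def LawInvariant (ρ : RiskMeasure P) : Prop :=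
  ∀ X Y : Lp ℝ 1 P, P.map X = P.map Y → ρ X = ρ Y

/-- The functional `ρ̃` on laws with `ρ̃(P ∘ X⁻¹) = ρ(X)` for `X ∈ L¹`. For law invariant `ρ` the
infimum runs over a single value, see `onLaw_map`; a measure that is not the law of an element
of `L¹` gets the value `⊤`. -/
noncomputable def onLaw (ρ : RiskMeasure P) (ν : Measure ℝ) : EReal :=
  ⨅ (X : Lp ℝ 1 P) (_ : P.map X = ν), ρ X

theorem onLaw_map {ρ : RiskMeasure P} (hρ : ρ.LawInvariant) (X : Lp ℝ 1 P) :
    ρ.onLaw (P.map X) = ρ X :=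
  le_antisymm (iInf₂_le (f := fun (Y : Lp ℝ 1 P) (_ : P.map Y = P.map X) => ρ Y) X rfl)
    (le_iInf₂ fun Y hY => (hρ Y X hY).ge)

/-- The conditional risk `ρ(X | 𝒢)(ω) = ρ̃(P(X ∈ · | 𝒢)(ω))`, where `P(X ∈ · | 𝒢)` is the regular
conditional law of `X` given the sub-σ-field `𝒢`. -/
noncomputable def condRisk {Ω : Type*} (𝒢 : MeasurableSpace Ω) {mΩ : MeasurableSpace Ω}
    [StandardBorelSpace Ω] {P : Measure Ω} [IsProbabilityMeasure P] (ρ : RiskMeasure P)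
    (X : Lp ℝ 1 P) (ω : Ω) : EReal :=
  ρ.onLaw ((condExpKernel P 𝒢 ω : Measure Ω).map X)

/-- `ρ` is acceptance consistent: `ρ(X) ≤ ρ(ρ(X | 𝒢))` for all sub-σ-fields `𝒢` and all `X ∈ L¹`
such that `ρ(X | 𝒢) ∈ L¹`, i.e. such that `ρ(X | 𝒢)` agrees almost surely with some `Z ∈ L¹`. -/
def AcceptanceConsistent [StandardBorelSpace Ω] (ρ : RiskMeasure P) : Prop :=
  ∀ 𝒢 : MeasurableSpace Ω, 𝒢 ≤ mΩ → ∀ X Z : Lp ℝ 1 P,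
    (∀ᵐ ω ∂P, ρ.condRisk 𝒢 X ω = ((Z ω : ℝ) : EReal)) → ρ X ≤ ρ Z

end RiskMeasure

/-- Finite first moment of a measure on a metric space. -/
def HasFiniteFirstMoment {E : Type*} [MetricSpace E] [MeasurableSpace E] (μ : Measure E) : Prop :=
  ∃ x₀ : E, Integrable (fun x => dist x x₀) μ

/-- The `ℓ¹`-metric on a finite product of metric spaces. -/
noncomputable def l1Dist {n : ℕ} {E : Fin n → Type*} [∀ i, MetricSpace (E i)]
    (x y : ∀ i, E i) : ℝ :=
  ∑ i, dist (x i) (y i)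

/-! The proof is by induction on the number of variables, splitting off `X 0` and conditioning on
the tail `T`. By independence, the conditional risk of `t * (f (X 0, T) - m)`, with `m` the mean, is
`g T`, where `g y` is the risk with the tail frozen at `y` (`condExpKernel_comap_map_of_indepFun`).
Put `k y = 𝔼 f (X 0, y)`. The section `f (·, y)` is 1-Lipschitz, so the one-variable bound and cash
additivity give `g y ≤ c + t * (k y - m)`. Acceptance consistency and monotonicity then bound the
risk by `c` plus that of `t * (k T - m)`. Averaging preserves the Lipschitz bound, so `k` is again
1-Lipschitz for the `ℓ¹`-metric, and `m` is the mean of `k T`; the induction hypothesis applies.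
Acceptance consistency needs `g T ∈ L¹`: monotonicity and cash additivity make `g` `t`-Lipschitz,
and first moments do the rest. -/

/-! ### Conditional laws under independence -/

/-- If `U` and `T` are independent, then the regular conditional law of `Φ (U, T)` given `σ(T)` is
obtained by freezing the value of `T`. -/
theorem condExpKernel_comap_map_of_indepFun {Ω A B : Type*} [mΩ : MeasurableSpace Ω]
    [StandardBorelSpace Ω] {P : Measure Ω} [IsProbabilityMeasure P] [MeasurableSpace A]
    [mB : MeasurableSpace B] {U : Ω → A} {T : Ω → B} (hU : Measurable U) (hT : Measurable T)
    (hUT : IndepFun T U P) {Φ : B → A → ℝ} (hΦ : Measurable (Function.uncurry Φ))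
    {Y : Ω → ℝ} (hY : Measurable Y) (hYΦ : Y =ᵐ[P] fun ω => Φ (T ω) (U ω)) :
    ∀ᵐ ω ∂P, (condExpKernel P (mB.comap T) ω).map Y = P.map (fun ω' => Φ (T ω) (U ω')) := by
  have hsec : ∀ y, Measurable (Φ y) := fun y => hΦ.comp measurable_prodMk_left
  have : IsProbabilityMeasure (P.map U) := Measure.isProbabilityMeasure_map hU.aemeasurable
  have hmeas : Measurable fun y => (P.map U).map (Φ y) := by
    refine Measure.measurable_of_measurable_coe _ fun s hs => ?_
    simp_rw [Measure.map_apply (hsec _) hs]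
    exact measurable_measure_prodMk_left (hΦ hs)
  let κ : Kernel B ℝ := ⟨fun y => (P.map U).map (Φ y), hmeas⟩
  have hκ : ∀ y, κ y = (P.map U).map (Φ y) := fun _ => rfl
  have : IsMarkovKernel κ :=
    ⟨fun y => by rw [hκ]; exact Measure.isProbabilityMeasure_map (hsec y).aemeasurable⟩
  -- Disintegrating the joint law along `T` identifies `κ` as the conditional law, by a.e.
  -- uniqueness.
  have hlaw : P.map (fun ω => (T ω, Y ω)) = P.map T ⊗ₘ κ := by
    have h1 : P.map (fun ω => (T ω, Y ω)) = P.map (fun ω => (T ω, Φ (T ω) (U ω))) :=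
      Measure.map_congr (hYΦ.mono fun ω hω => congrArg (Prod.mk (T ω)) hω)
    have hm : Measurable fun p : B × A => (p.1, Φ p.1 p.2) := measurable_fst.prodMk hΦ
    have h2 : P.map (fun ω => (T ω, Φ (T ω) (U ω))) =
        ((P.map T).prod (P.map U)).map (fun p => (p.1, Φ p.1 p.2)) := by
      rw [← hUT.map_prod_eq_prod_map_map hT.aemeasurable hU.aemeasurable,
        Measure.map_map hm (hT.prodMk hU)]
      rfl
    ext s hs
    rw [h1, h2, Measure.map_apply hm hs, Measure.prod_apply (hm hs), Measure.compProd_apply hs]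
    refine lintegral_congr fun y => ?_
    rw [hκ, Measure.map_apply (hsec y) (measurable_prodMk_left hs)]
    rfl
  have hcond := ae_of_ae_map hT.aemeasurable
    (condDistrib_ae_eq_of_measure_eq_compProd T hY.aemeasurable hlaw)
  -- The two conditional laws agree a.e. for each fixed set; rational half-lines form a countable
  -- generating π-system, so one null set suffices.
  have hall : ∀ᵐ ω ∂P, ∀ q : ℚ, condDistrib Y T P (T ω) (Set.Iic (q : ℝ)) =
      (condExpKernel P (mB.comap T)).map Y ω (Set.Iic (q : ℝ)) :=
    ae_all_iff.2 fun q => condDistrib_apply_ae_eq_condExpKernel_map hY hT measurableSet_Iic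
  filter_upwards [hcond, hall] with ω h1 h2
  have h3 : (condExpKernel P (mB.comap T) ω).map Y = κ (T ω) := by
    have : IsProbabilityMeasure ((condExpKernel P (mB.comap T) ω).map Y) :=
      Measure.isProbabilityMeasure_map
        (hY.mono le_rfl le_rfl).aemeasurable
    refine MeasureTheory.ext_of_generate_finite _ Real.borel_eq_generateFrom_Iic_rat
      Real.isPiSystem_Iic_rat ?_ (by simp)
    intro s hs
    obtain ⟨q, rfl⟩ := Set.mem_iUnion.1 hs
    rw [← h1, h2 q, Kernel.map_apply _ hY]
  rw [h3, hκ, Measure.map_map (hsec _) hU]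
  rfl

/-! ### Risk measures on integrable functions -/

namespace RiskMeasure

variable {Ω : Type*} {mΩ : MeasurableSpace Ω} {P : Measure Ω} [IsProbabilityMeasure P]

theorem toL1_mono (ρ : RiskMeasure P) {u v : Ω → ℝ} (hu : Integrable u P) (hv : Integrable v P)
    (h : ∀ ω, u ω ≤ v ω) : ρ (hu.toL1 u) ≤ ρ (hv.toL1 v) := by
  refine ρ.mono _ _ ?_
  rw [← Lp.coeFn_le]
  filter_upwards [hu.coeFn_toL1, hv.coeFn_toL1] with ω h1 h2
  rw [h1, h2]
  exact h ω

theorem toL1_add_const (ρ : RiskMeasure P) {u v : Ω → ℝ} (hu : Integrable u P)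
    (hv : Integrable v P) {c : ℝ} (h : ∀ ω, v ω = u ω + c) :
    ρ (hv.toL1 v) = ρ (hu.toL1 u) + (c : EReal) := by
  rw [← ρ.cash_additive]
  congr 1
  refine Lp.ext ?_
  filter_upwards [hu.coeFn_toL1, hv.coeFn_toL1, Lp.coeFn_add (hu.toL1 u) (Lp.const 1 P c),
    Lp.coeFn_const (p := 1) (μ := P) (c := c)] with ω h1 h2 h3 h4
  rw [h3, h2, Pi.add_apply, h1, h4, h ω]
  rfl

theorem toL1_zero (ρ : RiskMeasure P) {u : Ω → ℝ} (hu : Integrable u P) (h : ∀ ω, u ω = 0) :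
    ρ (hu.toL1 u) = 0 := by
  obtain rfl : u = 0 := funext h
  rw [Integrable.toL1_zero, ρ.normalized]

/-- Acceptance consistency for a function of two independent variables: freezing the second one
and evaluating the risk gives an upper bound. -/
theorem AcceptanceConsistent.le_of_indepFun [StandardBorelSpace Ω] {ρ : RiskMeasure P}
    (hlaw : ρ.LawInvariant) (hacc : ρ.AcceptanceConsistent) {A B : Type*} [MeasurableSpace A]
    [mB : MeasurableSpace B] {U : Ω → A} {T : Ω → B} (hU : Measurable U) (hT : Measurable T)
    (hUT : IndepFun T U P) {Φ : B → A → ℝ} (hΦ : Measurable (Function.uncurry Φ))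
    (hint : Integrable (fun ω => Φ (T ω) (U ω)) P)
    (hsec : ∀ y, Integrable (fun ω => Φ y (U ω)) P) {g : B → ℝ}
    (hg : ∀ y, ρ ((hsec y).toL1 _) = (g y : EReal)) (hgT : Integrable (fun ω => g (T ω)) P) :
    ρ (hint.toL1 _) ≤ ρ (hgT.toL1 _) := by
  refine hacc (mB.comap T) hT.comap_le _ _ ?_
  filter_upwards [condExpKernel_comap_map_of_indepFun hU hT hUT hΦ
    (Lp.stronglyMeasurable (hint.toL1 _)).measurable hint.coeFn_toL1, hgT.coeFn_toL1] with ω h1 h2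
  rw [condRisk, h1, h2, ← hg, ← onLaw_map hlaw]
  congr 1
  exact Measure.map_congr (hsec (T ω)).coeFn_toL1.symm

end RiskMeasure

/-! ### Lipschitz functions for the `ℓ¹`-metric -/

section l1Dist

variable {n : ℕ} {E : Fin n → Type*} [∀ i, MetricSpace (E i)]

/-- The product type carries the sup metric, so the `ℓ¹` bound is explicit; `l1Dist` is continuous
for the product topology. -/
theorem continuous_of_abs_sub_le_mul_l1Dist {f : (∀ i, E i) → ℝ} {K : ℝ}
    (hf : ∀ x y, |f x - f y| ≤ K * l1Dist x y) : Continuous f := by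
  refine continuous_iff_continuousAt.2 fun x => ?_
  rw [ContinuousAt, tendsto_iff_dist_tendsto_zero]
  have hlim : Filter.Tendsto (fun y => K * l1Dist y x) (nhds x) (nhds 0) := by
    have : Continuous fun y : ∀ i, E i => K * l1Dist y x := by
      unfold l1Dist
      fun_prop
    simpa [l1Dist] using this.tendsto x
  exact squeeze_zero (fun _ => dist_nonneg) (fun y => hf y x) hlim

variable [∀ i, TopologicalSpace.SeparableSpace (E i)] [∀ i, MeasurableSpace (E i)]
  [∀ i, BorelSpace (E i)]

/-- Second countability makes the product σ-field Borel, so continuity is enough. -/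
theorem measurable_of_abs_sub_le_mul_l1Dist {f : (∀ i, E i) → ℝ} {K : ℝ}
    (hf : ∀ x y, |f x - f y| ≤ K * l1Dist x y) : Measurable f := by
  have : ∀ i, SecondCountableTopology (E i) := fun i =>
    UniformSpace.secondCountable_of_separable (E i)
  exact (continuous_of_abs_sub_le_mul_l1Dist hf).measurable

theorem integrable_of_abs_sub_le_mul_l1Dist {Ω : Type*} [MeasurableSpace Ω] {P : Measure Ω}
    [IsProbabilityMeasure P] {X : ∀ i, Ω → E i} (hX : ∀ i, Measurable (X i))
    (hmoment : ∀ i, HasFiniteFirstMoment (P.map (X i))) {f : (∀ i, E i) → ℝ} {K : ℝ}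
    (hf : ∀ x y, |f x - f y| ≤ K * l1Dist x y) : Integrable (fun ω => f (fun i => X i ω)) P := by
  choose x₀ hx₀ using hmoment
  have hint : Integrable (fun ω => K * l1Dist (fun i => X i ω) x₀ + |f x₀|) P :=
    ((integrable_finsetSum _ fun i _ =>
      (hx₀ i).comp_measurable (hX i)).const_mul K).add (integrable_const _)
  refine hint.mono' ((measurable_of_abs_sub_le_mul_l1Dist hf).comp
    (measurable_pi_lambda _ hX)).aestronglyMeasurable (.of_forall fun ω => ?_)
  have h1 := hf (fun i => X i ω) x₀
  have h2 := abs_sub_abs_le_abs_sub (f fun i => X i ω) (f x₀)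
  rw [Real.norm_eq_abs]
  linarith

end l1Dist

theorem l1Dist_cons {n : ℕ} {E : Fin (n + 1) → Type*} [∀ i, MetricSpace (E i)] (a b : E 0)
    (x y : ∀ i : Fin n, E i.succ) :
    l1Dist (Fin.cons a x : ∀ i, E i) (Fin.cons b y) = dist a b + l1Dist x y := by
  simp [l1Dist, Fin.sum_univ_succ]

theorem ProbabilityTheory.iIndepFun.indepFun_tail {Ω : Type*} [MeasurableSpace Ω] {P : Measure Ω}
    {n : ℕ} {E : Fin (n + 1) → Type*} [∀ i, MeasurableSpace (E i)] {X : ∀ i, Ω → E i}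
    (h : iIndepFun X P) (hX : ∀ i, Measurable (X i)) :
    IndepFun (fun ω (i : Fin n) => X i.succ ω) (X 0) P := by
  have h1 := h.indepFun_finset (Finset.univ.erase 0) {0} (by simp) hX
  let φ : (∀ i : (Finset.univ.erase 0 : Finset (Fin (n + 1))), E i) → ∀ i : Fin n, E i.succ :=
    fun x i => x ⟨i.succ, by simp [Fin.succ_ne_zero]⟩
  let ψ : (∀ i : ({0} : Finset (Fin (n + 1))), E i) → E 0 := fun x => x ⟨0, by simp⟩
  have hφ : Measurable φ := measurable_pi_lambda _ fun i => measurable_pi_apply _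
  have hψ : Measurable ψ := measurable_pi_apply _
  exact h1.comp hφ hψ

/-! ### Induction on the number of variables -/

/-- The bound for `f (X₀, …, Xₙ)`, given the bound for functions of `X₁, …, Xₙ`. -/
theorem RiskMeasure.le_add_of_tail {Ω : Type*} [MeasurableSpace Ω] [StandardBorelSpace Ω]
    {P : Measure Ω} [IsProbabilityMeasure P]
    {ρ : RiskMeasure P} (hlaw : ρ.LawInvariant) (hacc : ρ.AcceptanceConsistent)
    {n : ℕ} {E : Fin (n + 1) → Type*} [∀ i, MetricSpace (E i)]
    [∀ i, TopologicalSpace.SeparableSpace (E i)]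
    [∀ i, MeasurableSpace (E i)] [∀ i, BorelSpace (E i)]
    {X : ∀ i, Ω → E i} (hX : ∀ i, Measurable (X i)) (hindep : iIndepFun X P)
    (hmoment : ∀ i, HasFiniteFirstMoment (P.map (X i))) {t : ℝ≥0} {c : ℝ} {C : EReal}
    (hhead : ∀ f : E 0 → ℝ, LipschitzWith 1 f →
      ∀ h : Integrable (fun ω => (t : ℝ) * (f (X 0 ω) - ∫ ω', f (X 0 ω') ∂P)) P,
        ρ (h.toL1 _) ≤ c)
    (htail : ∀ f : (∀ i : Fin n, E i.succ) → ℝ, (∀ x y, |f x - f y| ≤ l1Dist x y) →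
      ∀ h : Integrable (fun ω => (t : ℝ) * (f (fun i => X i.succ ω) -
        ∫ ω', f (fun i => X i.succ ω') ∂P)) P, ρ (h.toL1 _) ≤ C)
    {f : (∀ i, E i) → ℝ} (hf : ∀ x y, |f x - f y| ≤ l1Dist x y)
    (h : Integrable (fun ω => (t : ℝ) *
        (f (fun i => X i ω) - ∫ ω', f (fun i => X i ω') ∂P)) P) :
    ρ (h.toL1 _) ≤ c + C := by
  set T : Ω → (∀ i : Fin n, E i.succ) := fun ω i => X i.succ ω
  have hT : Measurable T := measurable_pi_lambda _ fun i => hX _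
  have hUT : IndepFun T (X 0) P := hindep.indepFun_tail hX
  set m : ℝ := ∫ ω', f (fun i => X i ω') ∂P
  let F : (∀ i : Fin n, E i.succ) → E 0 → ℝ := fun y x => f (Fin.cons x y)
  have hFX : ∀ ω, f (fun i => X i ω) = F (T ω) (X 0 ω) := fun ω =>
    congrArg f (Fin.cons_self_tail fun i => X i ω).symm
  have hfmeas : Measurable f :=
    measurable_of_abs_sub_le_mul_l1Dist (K := 1) (by simpa using hf)
  have hfint : Integrable (fun ω => f (fun i => X i ω)) P :=
    integrable_of_abs_sub_le_mul_l1Dist (K := 1) hX hmoment (by simpa using hf)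
  have hFmeas : Measurable (Function.uncurry F) := by
    refine hfmeas.comp (measurable_pi_lambda _ fun i => ?_)
    refine Fin.cases ?_ (fun j => ?_) i
    · exact measurable_snd
    · exact (measurable_pi_apply j).comp measurable_fst
  have hFtail : ∀ y y' x, |F y x - F y' x| ≤ l1Dist y y' := fun y y' x => by
    simpa [F, l1Dist_cons] using hf (Fin.cons x y) (Fin.cons x y')
  have hFhead : ∀ y, LipschitzWith 1 (F y) := fun y => by
    refine LipschitzWith.of_dist_le_mul fun x x' => ?_
    have hself : l1Dist y y = 0 := by simp [l1Dist]
    simpa [F, l1Dist_cons, hself, Real.dist_eq] using hf (Fin.cons x y) (Fin.cons x' y)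
  have hFint : ∀ y, Integrable (fun ω => F y (X 0 ω)) P := fun y => by
    obtain ⟨x₀, hx₀⟩ := hmoment 0
    refine ((hx₀.comp_measurable (hX 0)).add (integrable_const |F y x₀|)).mono'
      ((hFmeas.comp measurable_prodMk_left).comp (hX 0)).aestronglyMeasurable
      (.of_forall fun ω => ?_)
    have h1 := (hFhead y).dist_le_mul (X 0 ω) x₀
    have h2 := abs_sub_abs_le_abs_sub (F y (X 0 ω)) (F y x₀)
    rw [Real.dist_eq, NNReal.coe_one, one_mul] at h1
    rw [Real.norm_eq_abs]
    simp only [Pi.add_apply, Function.comp_apply]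
    linarith
  let k : (∀ i : Fin n, E i.succ) → ℝ := fun y => ∫ ω, F y (X 0 ω) ∂P
  have hk : ∀ y y', |k y - k y'| ≤ l1Dist y y' := fun y y' => by
    rw [← integral_sub (hFint y) (hFint y'), ← Real.norm_eq_abs]
    refine (norm_integral_le_of_norm_le_const (C := l1Dist y y')
      (.of_forall fun ω => hFtail y y' _)).trans (by simp)
  have hkint : Integrable (fun ω => k (T ω)) P :=
    integrable_of_abs_sub_le_mul_l1Dist (K := 1) (fun i : Fin n => hX i.succ)
      (fun i => hmoment i.succ) (by simpa using hk)
  -- Fubini for the product law of `(T, X 0)`.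
  have hkm : ∫ ω, k (T ω) ∂P = m := by
    have hprod := hUT.map_prod_eq_prod_map_map hT.aemeasurable (hX 0).aemeasurable
    have hsm : StronglyMeasurable (Function.uncurry F) := hFmeas.stronglyMeasurable
    have : IsProbabilityMeasure (P.map (X 0)) :=
      Measure.isProbabilityMeasure_map (hX 0).aemeasurable
    have : IsProbabilityMeasure (P.map T) := Measure.isProbabilityMeasure_map hT.aemeasurable
    have hjoint : Integrable (Function.uncurry F) ((P.map T).prod (P.map (X 0))) := by
      rw [← hprod, integrable_map_measure hsm.aestronglyMeasurable
        (hT.prodMk (hX 0)).aemeasurable]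
      exact hfint.congr (.of_forall hFX)
    calc ∫ ω, k (T ω) ∂P = ∫ y, k y ∂(P.map T) :=
          (integral_map hT.aemeasurable (measurable_of_abs_sub_le_mul_l1Dist (K := 1)
            (by simpa using hk)).aestronglyMeasurable).symm
      _ = ∫ y, ∫ x, F y x ∂(P.map (X 0)) ∂(P.map T) :=
          integral_congr_ae (.of_forall fun y => (integral_map (hX 0).aemeasurable
            (hFmeas.comp measurable_prodMk_left).aestronglyMeasurable).symm)
      _ = ∫ p, Function.uncurry F p ∂(P.map fun ω => (T ω, X 0 ω)) := by
          rw [hprod, integral_prod _ hjoint]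
          rfl
      _ = ∫ ω, F (T ω) (X 0 ω) ∂P :=
          integral_map (hT.prodMk (hX 0)).aemeasurable hsm.aestronglyMeasurable
      _ = m := integral_congr_ae (.of_forall fun ω => (hFX ω).symm)
  let Φ : (∀ i : Fin n, E i.succ) → E 0 → ℝ := fun y x => t * (F y x - m)
  have hΦmeas : Measurable (Function.uncurry Φ) := (hFmeas.sub_const m).const_mul _
  have hsec : ∀ y, Integrable (fun ω => Φ y (X 0 ω)) P := fun y =>
    ((hFint y).sub (integrable_const m)).const_mul _
  have hupper : ∀ y, ρ ((hsec y).toL1 _) ≤ ((c + t * (k y - m) : ℝ) : EReal) := fun y => by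
    have hcent : Integrable (fun ω => (t : ℝ) * (F y (X 0 ω) - ∫ ω', F y (X 0 ω') ∂P)) P :=
      ((hFint y).sub (integrable_const _)).const_mul _
    rw [ρ.toL1_add_const hcent (hsec y) (c := t * (k y - m)) (fun ω => by simp only [Φ, k]; ring),
      EReal.coe_add]
    exact add_le_add_left (hhead _ (hFhead y) hcent) _
  -- `toReal` loses nothing: the risk is below a real number because `c` is real, and it is never
  -- `⊥`.
  let g : (∀ i : Fin n, E i.succ) → ℝ := fun y => (ρ ((hsec y).toL1 _)).toReal
  have hg : ∀ y, ρ ((hsec y).toL1 _) = (g y : EReal) := fun y =>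
    (EReal.coe_toReal ((hupper y).trans_lt (EReal.coe_lt_top _)).ne (ρ.ne_bot _)).symm
  -- Changing the frozen tail moves the position by at most the constant `t * l1Dist y y'`.
  have hg_le : ∀ y y', g y ≤ g y' + t * l1Dist y y' := fun y y' => by
    have hshift : Integrable (fun ω => Φ y' (X 0 ω) + t * l1Dist y y') P :=
      (hsec y').add (integrable_const _)
    have hle := ρ.toL1_mono (hsec y) hshift fun ω => by
      have := mul_le_mul_of_nonneg_left (le_of_abs_le (hFtail y y' (X 0 ω))) t.coe_nonneg
      simp only [Φ]
      linarith
    rw [ρ.toL1_add_const (hsec y') hshift fun _ => rfl, hg, hg, ← EReal.coe_add] at hle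
    exact EReal.coe_le_coe_iff.1 hle
  have hglip : ∀ y y', |g y - g y'| ≤ t * l1Dist y y' := fun y y' => by
    have hcomm : l1Dist y' y = l1Dist y y' := by simp only [l1Dist, dist_comm]
    have h1 := hg_le y y'
    have h2 := hg_le y' y
    rw [hcomm] at h2
    exact abs_le.2 ⟨by linarith, by linarith⟩
  have hgint : Integrable (fun ω => g (T ω)) P :=
    integrable_of_abs_sub_le_mul_l1Dist (fun i : Fin n => hX i.succ)
      (fun i => hmoment i.succ) hglip
  have hΦint : Integrable (fun ω => Φ (T ω) (X 0 ω)) P :=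
    h.congr (.of_forall fun ω => by simp only [Φ, hFX])
  have hcent : Integrable (fun ω => (t : ℝ) * (k (T ω) - ∫ ω', k (T ω') ∂P)) P :=
    (hkint.sub (integrable_const _)).const_mul _
  have hbound : Integrable (fun ω => (t : ℝ) * (k (T ω) - ∫ ω', k (T ω') ∂P) + c) P :=
    hcent.add (integrable_const _)
  calc ρ (h.toL1 _) ≤ ρ (hΦint.toL1 _) := ρ.toL1_mono _ _ fun ω => by simp only [Φ, hFX, le_refl]
    _ ≤ ρ (hgint.toL1 _) := hacc.le_of_indepFun hlaw (hX 0) hT hUT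
        hΦmeas hΦint hsec hg hgint
    _ ≤ ρ (hbound.toL1 _) := ρ.toL1_mono _ _ fun ω => by
        have := hupper (T ω)
        rw [hg, EReal.coe_le_coe_iff] at this
        rw [hkm]
        linarith
    _ = ρ (hcent.toL1 _) + c := ρ.toL1_add_const _ _ fun _ => rfl
    _ ≤ C + c := add_le_add_left (htail k hk hcent) _
    _ = c + C := add_comm _ _

theorem RiskMeasure.le_sum_of_iIndepFun {Ω : Type*} [MeasurableSpace Ω] [StandardBorelSpace Ω]
    {P : Measure Ω} [IsProbabilityMeasure P]
    {ρ : RiskMeasure P} (hlaw : ρ.LawInvariant) (hacc : ρ.AcceptanceConsistent) {t : ℝ≥0}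
    {n : ℕ} {E : Fin n → Type*} [∀ i, MetricSpace (E i)]
    [∀ i, TopologicalSpace.SeparableSpace (E i)]
    [∀ i, MeasurableSpace (E i)] [∀ i, BorelSpace (E i)]
    {X : ∀ i, Ω → E i} (hX : ∀ i, Measurable (X i)) (hindep : iIndepFun X P)
    (hmoment : ∀ i, HasFiniteFirstMoment (P.map (X i))) {c : Fin n → EReal}
    (hc : ∀ (i : Fin n) (f : E i → ℝ), LipschitzWith 1 f →
      ∀ h : Integrable (fun ω => (t : ℝ) * (f (X i ω) - ∫ ω', f (X i ω') ∂P)) P,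
        ρ (h.toL1 _) ≤ c i)
    {f : (∀ i, E i) → ℝ} (hf : ∀ x y, |f x - f y| ≤ l1Dist x y)
    (h : Integrable (fun ω => (t : ℝ) *
        (f (fun i => X i ω) - ∫ ω', f (fun i => X i ω') ∂P)) P) :
    ρ (h.toL1 _) ≤ ∑ i, c i := by
  induction n with
  | zero =>
    refine (ρ.toL1_zero h fun ω => ?_).le.trans (by simp)
    have hconst : ∀ ω', f (fun i => X i ω') = f (fun i => X i ω) := fun ω' =>
      congrArg f (Subsingleton.elim _ _)
    simp [hconst]
  | succ n ih =>
    -- Test with `f = 0`. Nonnegativity excludes `⊤ + ⊥ = ⊥` in the sum, so an infinite `c 0` makes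
    -- the bound trivial.
    have hc0 : ∀ i, 0 ≤ c i := fun i => by
      have hz : Integrable (fun ω => (t : ℝ) *
          ((fun _ : E i => (0 : ℝ)) (X i ω) - ∫ ω', (fun _ : E i => (0 : ℝ)) (X i ω') ∂P)) P := by
        simp
      rw [← ρ.toL1_zero hz fun ω => by simp]
      exact hc i _ (LipschitzWith.const' 0) hz
    have hS : 0 ≤ ∑ i : Fin n, c i.succ := Finset.sum_nonneg fun i _ => hc0 _
    rw [Fin.sum_univ_succ]
    rcases eq_or_ne (c 0) ⊤ with htop | htop
    · rw [htop, EReal.top_add_of_ne_bot (ne_bot_of_le_ne_bot EReal.zero_ne_bot hS)]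
      exact le_top
    · have hbot : c 0 ≠ ⊥ := ne_bot_of_le_ne_bot EReal.zero_ne_bot (hc0 0)
      have hc' := hc 0
      rw [← EReal.coe_toReal htop hbot] at hc' ⊢
      exact RiskMeasure.le_add_of_tail hlaw hacc hX hindep hmoment hc'
        (fun f' hf' h' => ih (fun i => hX i.succ)
          (hindep.precomp (Fin.succ_injective n)) (fun i => hmoment i.succ)
          (fun i => hc i.succ) hf' h') hf h

theorem mainTheorem7 {Ω : Type*} [MeasurableSpace Ω] [StandardBorelSpace Ω]
    (P : Measure Ω) [IsProbabilityMeasure P] [NullSingletonClass P]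
    (ρ : RiskMeasure P) (hlaw : ρ.LawInvariant) (hacc : ρ.AcceptanceConsistent)
    (n : ℕ) (E : Fin n → Type*) [∀ i, MetricSpace (E i)] [∀ i, CompleteSpace (E i)]
    [∀ i, TopologicalSpace.SeparableSpace (E i)]
    [∀ i, MeasurableSpace (E i)] [∀ i, BorelSpace (E i)]
    (X : ∀ i, Ω → E i) (hX : ∀ i, Measurable (X i)) (hindep : iIndepFun X P)
    (hmoment : ∀ i, HasFiniteFirstMoment (P.map (X i)))
    (γ : Fin n → ℝ≥0 → EReal)
    (hγ : ∀ (i : Fin n) (t : ℝ≥0) (f : E i → ℝ), LipschitzWith 1 f →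
      ∀ h : Integrable (fun ω => (t : ℝ) * (f (X i ω) - ∫ ω', f (X i ω') ∂P)) P,
        ρ (h.toL1 _) ≤ γ i t)
    (f : (∀ i, E i) → ℝ) (hf : ∀ x y, |f x - f y| ≤ l1Dist x y) :
    Integrable (fun ω => f (fun i => X i ω)) P ∧
    ∀ t : ℝ≥0, ∃ h : Integrable (fun ω => (t : ℝ) *
        (f (fun i => X i ω) - ∫ ω', f (fun i => X i ω') ∂P)) P,
      ρ (h.toL1 _) ≤ ∑ i, γ i t := by
  have hint : Integrable (fun ω => f (fun i => X i ω)) P :=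
    integrable_of_abs_sub_le_mul_l1Dist (K := 1) hX hmoment (by simpa using hf)
  refine ⟨hint, fun t => ⟨(hint.sub (integrable_const _)).const_mul _, ?_⟩⟩
  exact RiskMeasure.le_sum_of_iIndepFun hlaw hacc hX hindep hmoment (fun i => hγ i t) hf _
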